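/- Let $n\ge 2$, let $x=(x_1,\dots,x_{n+1})$ be the standard coordinate system on $\mathbb{R}^{n+1}$, and let $y=(y_1,\dots,y_{n+1})$ be another (global) $C^2$ coordinate system on $\mathbb{R}^{n+1}$, that is, a $C^2$ diffeomorphism $x\mapsto y(x)$ (with $C^2$ inverse) from $\mathbb{R}^{n+1}$ onto an open subset of $\mathbb{R}^{n+1}$. Suppose that for every $C^2$ function $\varphi:\mathbb{R}^{n+1}\to\mathbb{R}$, $$\sum_{i=1}^{n}\frac{\partial^2\varphi}{\partial x_i^2}-\frac{\partial^2\varphi}{\partial x_{n+1}^2}=0 \text{ on } \mathbb{R}^{n+1}\quad\Longleftrightarrow\quad \sum_{i=1}^{n}\frac{\partial^2\varphi}{\partial y_i^2}-\frac{\partial^2\varphi}{\partial y_{n+1}^2}=0 \text{ on } \mathbb{R}^{n+1},$$ where $\partial\varphi/\partial y_i$ denotes the partial derivative of $\varphi$ expressed as a function of $y$. Then the coordinate transformation $x\mapsto y$ and its inverse are $C^\infty$; moreover, $x\mapsto y$ is an invertible affine map of $\mathbb{R}^{n+1}$ onto itself. -/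

import Mathlib

open scoped ContDiff

/-- `ℝ^{n+1}`; the last coordinate is the time coordinate. -/
abbrev Spacetime (n : ℕ) : Type := EuclideanSpace ℝ (Fin (n + 1))

/-- `Y = (y_1, …, y_{n+1})` is a (global) `C^k` coordinate system on `ℝ^{n+1}`: a `C^k`
diffeomorphism from the whole of `ℝ^{n+1}` onto an open subset of `ℝ^{n+1}`. -/
structure IsCoordinateSystem {n : ℕ} (k : WithTop ℕ∞)
    (Y : OpenPartialHomeomorph (Spacetime n) (Spacetime n)) : Prop where
  source_eq : Y.source = Set.univ
  contDiffOn : ContDiffOn ℝ k Y Y.source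
  contDiffOn_symm : ContDiffOn ℝ k Y.symm Y.target

/-- The standard coordinate system `(x_1, …, x_{n+1})`. -/
def standardCoordinates (n : ℕ) : OpenPartialHomeomorph (Spacetime n) (Spacetime n) :=
  OpenPartialHomeomorph.refl (Spacetime n)

/-- The function `∂φ/∂y_i`: express `φ` in the coordinates `Y`, and take the derivative in the
direction of the `i`-th coordinate. -/
noncomputable def coordPartial {n : ℕ} (Y : OpenPartialHomeomorph (Spacetime n) (Spacetime n))
    (i : Fin (n + 1)) (φ : Spacetime n → ℝ) : Spacetime n → ℝ :=
  fun p => lineDeriv ℝ (φ ∘ Y.symm) (Y p) (EuclideanSpace.single i 1)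

/-- `φ` satisfies, on all of `ℝ^{n+1}`, the wave equation
`∑_{i ≤ n} ∂²φ/∂y_i² - ∂²φ/∂y_{n+1}² = 0` with respect to the coordinates `Y`. -/
def SatisfiesWaveEquation {n : ℕ} (Y : OpenPartialHomeomorph (Spacetime n) (Spacetime n))
    (φ : Spacetime n → ℝ) : Prop :=
  ∀ p : Spacetime n,
    (∑ i : Fin n, coordPartial Y i.castSucc (coordPartial Y i.castSucc φ) p)
      - coordPartial Y (Fin.last n) (coordPartial Y (Fin.last n) φ) p = 0

/-! Write η for the Minkowski matrix and J for the Jacobian of `Y`. By the hypothesis, ψ ∘ `Y`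
solves the wave equation whenever ψ does, and linear and quadratic polynomials ψ suffice as tests.
Coordinate functions show that each component of `Y` is a solution. Quadratic ones centred at a
point of the image give J η Jᵀ = c η with a scalar function c (`gradientForm_eq_of_preserves`),
hence Jᵀ η J = c η.

Differentiating the latter once expresses ⟨∂ₖ∂ᵢY, ∂ⱼY⟩ through the gradient of c, as for Christoffel
symbols. Its trace over k = i vanishes because the components are solutions, which reads (2 - (n +
1)) ∂ⱼc = 0. So c is constant, the second derivatives vanish since J is invertible, and `Y` is
affine. No third derivative occurs, so C² is enough. -/

/-! ### Calculus of partial derivatives and the wave operator -/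

section CoordinateDerivatives

variable {n : ℕ}

/-- The partial derivative in the direction of the `i`-th standard coordinate. -/
noncomputable def partialDeriv (i : Fin (n + 1)) (f : Spacetime n → ℝ) : Spacetime n → ℝ :=
  fun p => lineDeriv ℝ f p (EuclideanSpace.single i 1)

/-- The diagonal entries of the Minkowski metric: `1` in space and `-1` in time. -/
def minkowskiSign (i : Fin (n + 1)) : ℝ := if i = Fin.last n then -1 else 1

theorem minkowskiSign_mul_self (i : Fin (n + 1)) : minkowskiSign i * minkowskiSign i = 1 := by
  unfold minkowskiSign
  split_ifs <;> norm_num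

/-- The wave operator in the standard coordinates. -/
noncomputable def dAlembertian (f : Spacetime n → ℝ) (p : Spacetime n) : ℝ :=
  ∑ i, minkowskiSign i * partialDeriv i (partialDeriv i f) p

theorem sum_minkowskiSign_mul (g : Fin (n + 1) → ℝ) :
    ∑ i, minkowskiSign i * g i = (∑ i : Fin n, g i.castSucc) - g (Fin.last n) := by
  rw [Fin.sum_univ_castSucc]
  simp [minkowskiSign, Fin.castSucc_ne_last, sub_eq_add_neg]

theorem coordPartial_standardCoordinates (i : Fin (n + 1)) (f : Spacetime n → ℝ) :
    coordPartial (standardCoordinates n) i f = partialDeriv i f := rfl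

theorem satisfiesWaveEquation_standardCoordinates_iff (f : Spacetime n → ℝ) :
    SatisfiesWaveEquation (standardCoordinates n) f ↔ ∀ p, dAlembertian f p = 0 := by
  simp only [SatisfiesWaveEquation, dAlembertian, coordPartial_standardCoordinates,
    sum_minkowskiSign_mul]

/-- `Y ∘ Y.symm` is the identity only on the target, but the target is open and a line derivative is
local. -/
theorem coordPartial_comp {Y : OpenPartialHomeomorph (Spacetime n) (Spacetime n)}
    (hs : Y.source = Set.univ) (i : Fin (n + 1)) (ψ : Spacetime n → ℝ) :
    coordPartial Y i (ψ ∘ Y) = partialDeriv i ψ ∘ Y := by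
  funext p
  have hp : Y p ∈ Y.target := Y.map_source (by simp [hs])
  apply Filter.EventuallyEq.lineDeriv_eq
  filter_upwards [Y.open_target.mem_nhds hp] with q hq
  simp [Y.right_inv hq]

theorem satisfiesWaveEquation_comp {Y : OpenPartialHomeomorph (Spacetime n) (Spacetime n)}
    (hs : Y.source = Set.univ) {ψ : Spacetime n → ℝ} (hψ : ∀ q, dAlembertian ψ q = 0) :
    SatisfiesWaveEquation Y (ψ ∘ Y) := by
  intro p
  simp only [coordPartial_comp hs]
  have := hψ (Y p)
  rwa [dAlembertian, sum_minkowskiSign_mul] at this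

theorem partialDeriv_eq_fderiv {f : Spacetime n → ℝ} (hf : Differentiable ℝ f)
    (i : Fin (n + 1)) :
    partialDeriv i f = fun p => fderiv ℝ f p (EuclideanSpace.single i 1) :=
  funext fun p => (hf p).lineDeriv_eq_fderiv

theorem ContDiff.partialDeriv {f : Spacetime n → ℝ} (hf : ContDiff ℝ 2 f) (i : Fin (n + 1)) :
    ContDiff ℝ 1 (partialDeriv i f) := by
  rw [partialDeriv_eq_fderiv (hf.differentiable (by norm_num))]
  exact (hf.fderiv_right (m := 1) (by norm_num)).clm_apply contDiff_const

theorem partialDeriv_comm {f : Spacetime n → ℝ} (hf : ContDiff ℝ 2 f) (i j : Fin (n + 1)) :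
    partialDeriv i (partialDeriv j f) = partialDeriv j (partialDeriv i f) := by
  have hd : Differentiable ℝ (fderiv ℝ f) :=
    (hf.fderiv_right (m := 1) (by norm_num)).differentiable (by norm_num)
  have key : ∀ (i j : Fin (n + 1)) (p : Spacetime n), partialDeriv i (partialDeriv j f) p =
      fderiv ℝ (fderiv ℝ f) p (EuclideanSpace.single i 1) (EuclideanSpace.single j 1) := by
    intro i j p
    rw [partialDeriv_eq_fderiv ((hf.partialDeriv j).differentiable (by norm_num)),
      partialDeriv_eq_fderiv (hf.differentiable (by norm_num))]
    simp only
    rw [fderiv_clm_apply (hd p) (differentiableAt_const _)]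
    simp
  funext p
  rw [key, key]
  exact (hf.contDiffAt.isSymmSndFDerivAt (by simp)) _ _

theorem partialDeriv_const (i : Fin (n + 1)) (c : ℝ) :
    partialDeriv i (fun _ : Spacetime n => c) = fun _ => 0 := by
  rw [partialDeriv_eq_fderiv (differentiable_const c)]
  simp

theorem partialDeriv_add {f g : Spacetime n → ℝ} (hf : Differentiable ℝ f)
    (hg : Differentiable ℝ g) (i : Fin (n + 1)) :
    partialDeriv i (fun p => f p + g p) = fun p => partialDeriv i f p + partialDeriv i g p := by
  rw [partialDeriv_eq_fderiv (hf.fun_add hg), partialDeriv_eq_fderiv hf, partialDeriv_eq_fderiv hg]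
  funext p
  rw [fderiv_fun_add (hf p) (hg p)]
  rfl

theorem partialDeriv_sum {ι : Type*} (s : Finset ι) {f : ι → Spacetime n → ℝ}
    (hf : ∀ a, Differentiable ℝ (f a)) (i : Fin (n + 1)) :
    partialDeriv i (fun p => ∑ a ∈ s, f a p) = fun p => ∑ a ∈ s, partialDeriv i (f a) p := by
  rw [partialDeriv_eq_fderiv (by fun_prop)]
  simp only [fun a => partialDeriv_eq_fderiv (hf a)]
  funext p
  rw [fderiv_fun_sum (fun a _ => hf a p)]
  simp

theorem partialDeriv_mul {f g : Spacetime n → ℝ} (hf : Differentiable ℝ f)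
    (hg : Differentiable ℝ g) (i : Fin (n + 1)) :
    partialDeriv i (fun p => f p * g p) =
      fun p => partialDeriv i f p * g p + f p * partialDeriv i g p := by
  rw [partialDeriv_eq_fderiv (hf.fun_mul hg), partialDeriv_eq_fderiv hf, partialDeriv_eq_fderiv hg]
  funext p
  rw [fderiv_fun_mul (hf p) (hg p)]
  simp
  ring

theorem partialDeriv_const_mul (c : ℝ) {f : Spacetime n → ℝ} (hf : Differentiable ℝ f)
    (i : Fin (n + 1)) :
    partialDeriv i (fun p => c * f p) = fun p => c * partialDeriv i f p := by
  rw [partialDeriv_mul (differentiable_const c) hf, partialDeriv_const]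
  simp

theorem partialDeriv_sub_const {f : Spacetime n → ℝ} (hf : Differentiable ℝ f) (c : ℝ)
    (i : Fin (n + 1)) :
    partialDeriv i (fun p => f p - c) = partialDeriv i f := by
  rw [partialDeriv_eq_fderiv (hf.fun_sub (differentiable_const c)), partialDeriv_eq_fderiv hf]
  funext p
  rw [fderiv_sub_const]

theorem partialDeriv_coord (i a : Fin (n + 1)) :
    partialDeriv i (fun q : Spacetime n => q a) = fun _ => if a = i then 1 else 0 := by
  have hd : Differentiable ℝ (fun q : Spacetime n => q a) := by fun_prop
  rw [partialDeriv_eq_fderiv hd]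
  funext p
  have : HasFDerivAt (fun q : Spacetime n => q a) (EuclideanSpace.proj a : Spacetime n →L[ℝ] ℝ) p :=
    (EuclideanSpace.proj a : Spacetime n →L[ℝ] ℝ).hasFDerivAt
  rw [this.fderiv]
  simp

theorem dAlembertian_coord (a : Fin (n + 1)) (p : Spacetime n) :
    dAlembertian (fun q : Spacetime n => q a) p = 0 := by
  simp [dAlembertian, partialDeriv_coord, partialDeriv_const]

theorem dAlembertian_sub_const {f : Spacetime n → ℝ} (hf : Differentiable ℝ f) (c : ℝ)
    (p : Spacetime n) : dAlembertian (fun q => f q - c) p = dAlembertian f p := by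
  simp [dAlembertian, partialDeriv_sub_const hf]

/-- The polarized Minkowski form of the gradients of `f` and `g`. -/
noncomputable def gradientForm (f g : Spacetime n → ℝ) (p : Spacetime n) : ℝ :=
  ∑ i, minkowskiSign i * (partialDeriv i f p * partialDeriv i g p)

theorem dAlembertian_mul {f g : Spacetime n → ℝ} (hf : ContDiff ℝ 2 f) (hg : ContDiff ℝ 2 g)
    (p : Spacetime n) :
    dAlembertian (fun q => f q * g q) p =
      dAlembertian f p * g p + f p * dAlembertian g p + 2 * gradientForm f g p := by
  have hf1 := hf.differentiable (by norm_num)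
  have hg1 := hg.differentiable (by norm_num)
  have hf2 := fun i => (hf.partialDeriv i).differentiable (by norm_num)
  have hg2 := fun i => (hg.partialDeriv i).differentiable (by norm_num)
  simp only [dAlembertian, gradientForm, Finset.mul_sum, Finset.sum_mul,
    ← Finset.sum_add_distrib]
  refine Finset.sum_congr rfl fun i _ => ?_
  rw [partialDeriv_mul hf1 hg1, partialDeriv_add ((hf2 i).fun_mul hg1) (hf1.fun_mul (hg2 i)),
    partialDeriv_mul (hf2 i) hg1, partialDeriv_mul hf1 (hg2 i)]
  ring

theorem dAlembertian_const_mul_add_const_mul (s t : ℝ) {f g : Spacetime n → ℝ}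
    (hf : ContDiff ℝ 2 f) (hg : ContDiff ℝ 2 g) (p : Spacetime n) :
    dAlembertian (fun q => s * f q + t * g q) p =
      s * dAlembertian f p + t * dAlembertian g p := by
  have hf1 := hf.differentiable (by norm_num)
  have hg1 := hg.differentiable (by norm_num)
  have hf2 := fun i => (hf.partialDeriv i).differentiable (by norm_num)
  have hg2 := fun i => (hg.partialDeriv i).differentiable (by norm_num)
  simp only [dAlembertian, Finset.mul_sum, ← Finset.sum_add_distrib]
  refine Finset.sum_congr rfl fun i _ => ?_
  rw [partialDeriv_add (hf1.const_mul s) (hg1.const_mul t), partialDeriv_const_mul s hf1,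
    partialDeriv_const_mul t hg1, partialDeriv_add ((hf2 i).const_mul s) ((hg2 i).const_mul t),
    partialDeriv_const_mul s (hf2 i), partialDeriv_const_mul t (hg2 i)]
  ring

theorem gradientForm_coord (a b : Fin (n + 1)) (p : Spacetime n) :
    gradientForm (fun q : Spacetime n => q a) (fun q => q b) p =
      if a = b then minkowskiSign a else 0 := by
  simp only [gradientForm, partialDeriv_coord, mul_ite, mul_one, mul_zero, Finset.sum_ite_eq,
    Finset.mem_univ, if_true]
  split_ifs <;> simp_all

theorem gradientForm_sub_const {f g : Spacetime n → ℝ} (hf : Differentiable ℝ f)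
    (hg : Differentiable ℝ g) (c d : ℝ) (p : Spacetime n) :
    gradientForm (fun q => f q - c) (fun q => g q - d) p = gradientForm f g p := by
  simp [gradientForm, partialDeriv_sub_const hf, partialDeriv_sub_const hg]

theorem ContDiff.gradientForm {f g : Spacetime n → ℝ} (hf : ContDiff ℝ 2 f)
    (hg : ContDiff ℝ 2 g) : ContDiff ℝ 1 (gradientForm f g) :=
  ContDiff.sum fun i _ => contDiff_const.mul ((hf.partialDeriv i).mul (hg.partialDeriv i))

theorem eq_of_partialDeriv_eq_zero {f : Spacetime n → ℝ} (hf : Differentiable ℝ f)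
    (h : ∀ i p, partialDeriv i f p = 0) (p q : Spacetime n) : f p = f q := by
  refine is_const_of_fderiv_eq_zero hf (fun x => ?_) p q
  apply ContinuousLinearMap.coe_injective
  refine (EuclideanSpace.basisFun (Fin (n + 1)) ℝ).toBasis.ext fun i => ?_
  have := h i x
  rw [partialDeriv_eq_fderiv hf] at this
  simpa using this

end CoordinateDerivatives

/-! ### Conformality and rigidity of maps preserving solutions -/

section Conformal

variable {n : ℕ}

/-- A `C²` map pulling back solutions of the wave equation to solutions is conformal for
the Minkowski metric. -/
theorem gradientForm_eq_of_preserves {F : Spacetime n → Spacetime n} (hF : ContDiff ℝ 2 F)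
    (hw : ∀ ψ : Spacetime n → ℝ, ContDiff ℝ 2 ψ → (∀ q, dAlembertian ψ q = 0) →
      ∀ p, dAlembertian (ψ ∘ F) p = 0) (p : Spacetime n) (a b : Fin (n + 1)) :
    gradientForm (fun q => F q a) (fun q => F q b) p =
      if a = b then minkowskiSign (Fin.last n) *
        gradientForm (fun q => F q (Fin.last n)) (fun q => F q (Fin.last n)) p *
          minkowskiSign a else 0 := by
  have hc : ∀ a, ContDiff ℝ 2 (fun q : Spacetime n => q a) := fun a => by fun_prop
  have hFc : ∀ a, ContDiff ℝ 2 (fun q => F q a) := fun a => (hc a).comp hF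
  -- The test quadratic is centred at `F p`, so in the product rule at `p` only the gradient terms
  -- survive; the premise says exactly that it is a solution.
  have key : ∀ (s t : ℝ) (a b c d : Fin (n + 1)),
      s * (if a = b then minkowskiSign a else 0) + t * (if c = d then minkowskiSign c else 0) = 0 →
      s * gradientForm (fun q => F q a) (fun q => F q b) p +
        t * gradientForm (fun q => F q c) (fun q => F q d) p = 0 := by
    intro s t a b c d h
    have hs : ∀ a, ContDiff ℝ 2 (fun q : Spacetime n => q a - F p a) :=
      fun a => (hc a).sub contDiff_const
    have hFs : ∀ a, ContDiff ℝ 2 (fun q => F q a - F p a) := fun a => (hFc a).sub contDiff_const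
    have hd := fun a => (hc a).differentiable (by norm_num)
    have hFd := fun a => (hFc a).differentiable (by norm_num)
    have := hw (fun q => s * ((q a - F p a) * (q b - F p b)) + t * ((q c - F p c) * (q d - F p d)))
      ((contDiff_const.mul ((hs a).mul (hs b))).add (contDiff_const.mul ((hs c).mul (hs d))))
      (fun q => by
        rw [dAlembertian_const_mul_add_const_mul s t ((hs a).mul (hs b)) ((hs c).mul (hs d)),
          dAlembertian_mul (hs a) (hs b), dAlembertian_mul (hs c) (hs d)]
        simp only [dAlembertian_sub_const (hd _), dAlembertian_coord,
          gradientForm_sub_const (hd _) (hd _), gradientForm_coord]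
        linear_combination 2 * h) p
    have e : (fun q => s * ((q a - F p a) * (q b - F p b)) +
        t * ((q c - F p c) * (q d - F p d))) ∘ F = fun q =>
          s * ((F q a - F p a) * (F q b - F p b)) + t * ((F q c - F p c) * (F q d - F p d)) := rfl
    rw [e, dAlembertian_const_mul_add_const_mul s t ((hFs a).mul (hFs b)) ((hFs c).mul (hFs d)),
      dAlembertian_mul (hFs a) (hFs b), dAlembertian_mul (hFs c) (hFs d),
      gradientForm_sub_const (hFd _) (hFd _), gradientForm_sub_const (hFd _) (hFd _)] at this
    linear_combination this / 2
  split_ifs with h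
  · subst h
    -- These weights cancel because both squared signs equal 1.
    have := key (minkowskiSign a) (-minkowskiSign (Fin.last n)) a a (Fin.last n) (Fin.last n) (by
      simp [minkowskiSign_mul_self])
    have h2 := minkowskiSign_mul_self a
    linear_combination minkowskiSign a * this -
      gradientForm (fun q => F q a) (fun q => F q a) p * h2
  · have := key 1 0 a b a b (by simp [h])
    simpa using this

/-- The Jacobian matrix, with rows indexed by the components of the map. -/
noncomputable def jacobian (F : Spacetime n → Spacetime n) (p : Spacetime n) :
    Matrix (Fin (n + 1)) (Fin (n + 1)) ℝ :=
  Matrix.of fun a i => partialDeriv i (fun q => F q a) p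

theorem jacobian_apply {F : Spacetime n → Spacetime n} (hF : Differentiable ℝ F)
    (p : Spacetime n) (a i : Fin (n + 1)) :
    jacobian F p a i = fderiv ℝ F p (EuclideanSpace.single i 1) a := by
  have hd : Differentiable ℝ (fun q => F q a) := by fun_prop
  have h : HasFDerivAt (fun q => F q a)
      ((EuclideanSpace.proj a : Spacetime n →L[ℝ] ℝ).comp (fderiv ℝ F p)) p :=
    (EuclideanSpace.proj a : Spacetime n →L[ℝ] ℝ).hasFDerivAt.comp p (hF p).hasFDerivAt
  simp only [jacobian, Matrix.of_apply]
  rw [partialDeriv_eq_fderiv hd]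
  simp only
  rw [h.fderiv]
  simp

theorem isUnit_jacobian {F : Spacetime n → Spacetime n} (hF : Differentiable ℝ F)
    {p : Spacetime n} (hinj : Function.Injective (fderiv ℝ F p)) : IsUnit (jacobian F p) := by
  rw [← Matrix.mulVec_injective_iff_isUnit]
  have key : ∀ v : Fin (n + 1) → ℝ,
      (jacobian F p).mulVec v = (fderiv ℝ F p (WithLp.toLp 2 v)).ofLp := by
    intro v
    have hv : (WithLp.toLp 2 v : Spacetime n) = ∑ i, v i • EuclideanSpace.single i (1 : ℝ) := by
      ext j
      simp [Pi.single_apply]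
    rw [hv]
    ext a
    simp [Matrix.mulVec, dotProduct, jacobian_apply hF, mul_comm]
  intro v w h
  simp only [key] at h
  exact WithLp.toLp_injective 2 (hinj (WithLp.ofLp_injective 2 h))

/-- Cancelling `J` on the left turns the hypothesis into `N Jᵀ N = c J⁻¹`; this needs no assumption
`c ≠ 0`. -/
theorem transpose_mul_mul_eq_of_mul_mul_transpose_eq {ι : Type*} [Fintype ι] [DecidableEq ι]
    {J N : Matrix ι ι ℝ} {c : ℝ} (hJ : IsUnit J) (hN : N * N = 1)
    (h : J * N * J.transpose = c • N) : J.transpose * N * J = c • N := by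
  obtain ⟨M, hM⟩ := hJ.exists_left_inv
  have h1 : N * J.transpose * N = c • M := by
    calc N * J.transpose * N = (M * J) * N * J.transpose * N := by rw [hM, one_mul]
      _ = M * (J * N * J.transpose) * N := by simp only [mul_assoc]
      _ = c • M := by simp [h, mul_assoc, hN]
  calc J.transpose * N * J = (N * N) * J.transpose * N * J := by rw [hN, one_mul]
    _ = N * (N * J.transpose * N) * J := by simp only [mul_assoc]
    _ = c • N := by simp [h1, mul_assoc, hM]

/-- Conformal Christoffel symbols with vanishing trace vanish in dimension other than two. -/
theorem eq_zero_of_conformal_of_trace {ι : Type*} [Fintype ι] [DecidableEq ι]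
    (hι : Fintype.card ι ≠ 2) {s l : ι → ℝ} (hs : ∀ i, s i * s i = 1) {C : ι → ι → ι → ℝ}
    (hsymm : ∀ k i j, C k i j = C i k j)
    (hconf : ∀ k i j, C k i j + C k j i = if i = j then l k * s i else 0)
    (htr : ∀ j, ∑ i, s i * C i i j = 0) (k i j : ι) : C k i j = 0 := by
  -- The Koszul permutation of indices.
  have h2 : ∀ k i j, 2 * C k i j = (if i = j then l k * s i else 0) +
      (if k = j then l i * s k else 0) - (if k = i then l j * s k else 0) := by
    intro k i j
    have h1 := hconf k i j
    have h3 := hconf i k j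
    have h4 := hconf j k i
    rw [hsymm j k i, hsymm j i k] at h4
    rw [hsymm i k j] at h3
    linear_combination h1 + h3 - h4
  have hl : ∀ j, l j = 0 := by
    intro j
    have h5 : ∀ i, 2 * (s i * C i i j) = (if i = j then 2 * l i else 0) - l j := by
      intro i
      have := h2 i i j
      have hsi := hs i
      rw [if_pos (rfl : i = i)] at this
      split_ifs at this ⊢ with h
      · linear_combination s i * this + (2 * l i - l j) * hsi
      · linear_combination s i * this - l j * hsi
    -- Contracting the first two indices: the diagonal term gives `2 * l j`, and each of the `card
    -- ι` summands gives `-l j`.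
    have h6 : 2 * ∑ i, s i * C i i j = (2 - (Fintype.card ι : ℝ)) * l j := by
      rw [Finset.mul_sum, Finset.sum_congr rfl fun i _ => h5 i, Finset.sum_sub_distrib]
      simp [sub_mul]
    rw [htr, mul_zero] at h6
    have h7 : (2 - (Fintype.card ι : ℝ)) ≠ 0 := sub_ne_zero.2 fun h => hι (by exact_mod_cast h.symm)
    exact (mul_eq_zero.1 h6.symm).resolve_left h7
  have := h2 k i j
  simpa [hl] using this

/-- A `C²` immersion pulling back solutions of the wave equation to solutions has vanishing second
derivatives. -/
theorem partialDeriv_partialDeriv_eq_zero_of_preserves (hn : 2 ≤ n)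
    {F : Spacetime n → Spacetime n} (hF : ContDiff ℝ 2 F)
    (hinj : ∀ p, Function.Injective (fderiv ℝ F p))
    (hw : ∀ ψ : Spacetime n → ℝ, ContDiff ℝ 2 ψ → (∀ q, dAlembertian ψ q = 0) →
      ∀ p, dAlembertian (ψ ∘ F) p = 0) (k i a : Fin (n + 1)) (p : Spacetime n) :
    partialDeriv k (partialDeriv i (fun q => F q a)) p = 0 := by
  have hFc : ∀ a, ContDiff ℝ 2 (fun q => F q a) := fun a => by fun_prop
  have hFd := fun a i => ((hFc a).partialDeriv i).differentiable (by norm_num)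
  -- The conformal factor, read off from the time component of `F`; it involves only first
  -- derivatives of `F`, so it can be differentiated once.
  obtain ⟨c, hc⟩ : ∃ c : Spacetime n → ℝ, c = fun p => minkowskiSign (Fin.last n) *
    gradientForm (fun q => F q (Fin.last n)) (fun q => F q (Fin.last n)) p := ⟨_, rfl⟩
  have hcd : Differentiable ℝ c := by
    rw [hc]
    exact (((hFc _).gradientForm (hFc _)).differentiable (by norm_num)).const_mul _
  have hG : ∀ p, jacobian F p * Matrix.diagonal minkowskiSign * (jacobian F p).transpose =
      c p • Matrix.diagonal minkowskiSign := by
    intro p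
    ext a b
    have := gradientForm_eq_of_preserves hF hw p a b
    rw [Matrix.mul_apply]
    simp only [Matrix.mul_diagonal, Matrix.transpose_apply, Matrix.smul_apply, smul_eq_mul, hc,
      Matrix.diagonal_apply, mul_ite, mul_zero, jacobian, Matrix.of_apply]
    rw [← this, gradientForm]
    exact Finset.sum_congr rfl fun i _ => by ring
  have hG' : ∀ i j p, ∑ a, minkowskiSign a *
      (partialDeriv i (fun q => F q a) p * partialDeriv j (fun q => F q a) p) =
        (if i = j then minkowskiSign i else 0) * c p := by
    intro i j p
    have := transpose_mul_mul_eq_of_mul_mul_transpose_eq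
      (isUnit_jacobian (hF.differentiable (by norm_num)) (hinj p))
      (by rw [Matrix.diagonal_mul_diagonal]; simp [minkowskiSign_mul_self]) (hG p)
    have := congrFun (congrFun this i) j
    rw [Matrix.mul_apply] at this
    simp only [Matrix.mul_diagonal, Matrix.transpose_apply, Matrix.smul_apply, smul_eq_mul,
      Matrix.diagonal_apply, jacobian, Matrix.of_apply] at this
    rw [mul_comm, ← this]
    exact Finset.sum_congr rfl fun i _ => by ring
  -- Here `C k i j` is ⟨∂ₖ∂ᵢF, ∂ⱼF⟩, and `2 ≤ n` enters as `n + 1 ≠ 2`. The three conditions are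
  -- symmetry of second derivatives, the derivative of `hG'`, and the wave equation for the
  -- components of `F`.
  have hC := eq_zero_of_conformal_of_trace (ι := Fin (n + 1)) (by simp; omega)
    minkowskiSign_mul_self (l := fun k => partialDeriv k c p)
    (C := fun k i j => ∑ a, minkowskiSign a *
      (partialDeriv k (partialDeriv i (fun q => F q a)) p * partialDeriv j (fun q => F q a) p))
    (fun k i j => by simp only [partialDeriv_comm (hFc _) k i])
    (fun k i j => by
      have := congrFun (congrArg (partialDeriv k) (funext (hG' i j))) p
      rw [partialDeriv_const_mul _ hcd, partialDeriv_sum _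
        fun a => ((hFd a i).fun_mul (hFd a j)).const_mul _] at this
      simp only [partialDeriv_const_mul _ ((hFd _ i).fun_mul (hFd _ j)),
        partialDeriv_mul (hFd _ i) (hFd _ j)] at this
      rw [← Finset.sum_add_distrib]
      have e : (if i = j then partialDeriv k c p * minkowskiSign i else 0) =
        (if i = j then minkowskiSign i else 0) * partialDeriv k c p := by
          split_ifs <;> ring
      rw [e, ← this]
      exact Finset.sum_congr rfl fun a _ => by ring)
    (fun j => by
      have hbox : ∀ a, dAlembertian (fun q => F q a) p = 0 := fun a =>
        hw (fun q => q a) (by fun_prop) (dAlembertian_coord a) p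
      simp only [Finset.mul_sum]
      rw [Finset.sum_comm]
      refine Finset.sum_eq_zero fun a _ => ?_
      have := hbox a
      rw [dAlembertian] at this
      calc _ = minkowskiSign a * partialDeriv j (fun q => F q a) p *
            ∑ i, minkowskiSign i * partialDeriv i (partialDeriv i (fun q => F q a)) p := by
            rw [Finset.mul_sum]
            exact Finset.sum_congr rfl fun i _ => by ring
        _ = 0 := by rw [this, mul_zero])
  -- The covector η ∂ₖ∂ᵢF kills every column of the invertible Jacobian, hence is zero.
  have hv : Matrix.vecMul
      (fun a => minkowskiSign a * partialDeriv k (partialDeriv i (fun q => F q a)) p)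
      (jacobian F p) = 0 := by
    ext j
    rw [Pi.zero_apply, ← hC k i j]
    simp only [Matrix.vecMul, dotProduct, jacobian, Matrix.of_apply, mul_assoc]
  have hz := Matrix.vecMul_injective_of_isUnit
    (isUnit_jacobian (hF.differentiable (by norm_num)) (hinj p))
    (hv.trans (Matrix.zero_vecMul _).symm)
  have := congrFun hz a
  have hs := minkowskiSign_mul_self a
  simp only [Pi.zero_apply] at this
  linear_combination minkowskiSign a * this -
    partialDeriv k (partialDeriv i (fun q => F q a)) p * hs

theorem eq_fderiv_add_of_preserves (hn : 2 ≤ n)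
    {F : Spacetime n → Spacetime n} (hF : ContDiff ℝ 2 F)
    (hinj : ∀ p, Function.Injective (fderiv ℝ F p))
    (hw : ∀ ψ : Spacetime n → ℝ, ContDiff ℝ 2 ψ → (∀ q, dAlembertian ψ q = 0) →
      ∀ p, dAlembertian (ψ ∘ F) p = 0) (p : Spacetime n) :
    F p = fderiv ℝ F 0 p + F 0 := by
  have hd : Differentiable ℝ F := hF.differentiable (by norm_num)
  have hconst : ∀ p, fderiv ℝ F p = fderiv ℝ F 0 := by
    intro p
    apply ContinuousLinearMap.coe_injective
    refine (EuclideanSpace.basisFun (Fin (n + 1)) ℝ).toBasis.ext fun i => ?_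
    ext a
    have hFa : ContDiff ℝ 2 (fun q => F q a) := by fun_prop
    have := eq_of_partialDeriv_eq_zero ((hFa.partialDeriv i).differentiable (by norm_num))
      (fun k q => partialDeriv_partialDeriv_eq_zero_of_preserves hn hF hinj hw k i a q) p 0
    have h1 := jacobian_apply hd p a i
    have h2 := jacobian_apply hd 0 a i
    simp only [jacobian, Matrix.of_apply] at h1 h2
    rw [h1, h2] at this
    simpa using this
  have := is_const_of_fderiv_eq_zero (f := fun q => F q - fderiv ℝ F 0 q)
    (hd.sub (fderiv ℝ F 0).differentiable) (fun q => by
      rw [fderiv_fun_sub (hd q) (fderiv ℝ F 0).differentiableAt, hconst q,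
        ContinuousLinearMap.fderiv, sub_self]) p 0
  simp only [map_zero, sub_zero] at this
  rw [← this]
  abel

end Conformal

/-! ### Application to the coordinate system -/

theorem corollary2p4 (n : ℕ) (hn : 2 ≤ n)
    (Y : OpenPartialHomeomorph (Spacetime n) (Spacetime n))
    (hY : IsCoordinateSystem 2 Y)
    (hwave : ∀ φ : Spacetime n → ℝ, ContDiff ℝ 2 φ →
      (SatisfiesWaveEquation (standardCoordinates n) φ ↔ SatisfiesWaveEquation Y φ)) :
    IsCoordinateSystem ∞ Y ∧
      ∃ A : Spacetime n ≃ᵃ[ℝ] Spacetime n, ∀ p : Spacetime n, Y p = A p := by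
  have hF : ContDiff ℝ 2 Y := by
    have := hY.contDiffOn
    rwa [hY.source_eq, contDiffOn_univ] at this
  -- Differentiating `Y.symm ∘ Y = id` gives a left inverse of the derivative.
  have hinj : ∀ p, Function.Injective (fderiv ℝ Y p) := by
    intro p
    have hp : Y p ∈ Y.target := Y.map_source (by simp [hY.source_eq])
    have hX : DifferentiableAt ℝ Y.symm (Y p) :=
      (hY.contDiffOn_symm.contDiffAt (Y.open_target.mem_nhds hp)).differentiableAt (by norm_num)
    have hid : Y.symm ∘ Y = id := funext fun q => Y.left_inv (by simp [hY.source_eq])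
    have hcomp := hX.hasFDerivAt.comp p (hF.differentiable (by norm_num) p).hasFDerivAt
    rw [hid] at hcomp
    have := hcomp.unique (hasFDerivAt_id p)
    exact Function.LeftInverse.injective (g := fderiv ℝ Y.symm (Y p)) fun v =>
      congrArg (fun L : Spacetime n →L[ℝ] Spacetime n => L v) this
  have hw : ∀ ψ : Spacetime n → ℝ, ContDiff ℝ 2 ψ → (∀ q, dAlembertian ψ q = 0) →
      ∀ p, dAlembertian (ψ ∘ Y) p = 0 := fun ψ hψ h =>
    (satisfiesWaveEquation_standardCoordinates_iff _).1
      ((hwave _ (hψ.comp hF)).2 (satisfiesWaveEquation_comp hY.source_eq h))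
  have haff := eq_fderiv_add_of_preserves hn hF hinj hw
  let L : Spacetime n ≃ₗ[ℝ] Spacetime n :=
    LinearEquiv.ofInjectiveEndo (fderiv ℝ Y 0).toLinearMap (hinj 0)
  have hL : ∀ p, Y p = L p + Y 0 := haff
  refine ⟨⟨hY.source_eq, ?_, ?_⟩,
    L.toAffineEquiv.trans (AffineEquiv.constVAdd ℝ _ (Y 0)), fun p => ?_⟩
  · have h : (Y : Spacetime n → Spacetime n) = fun p => fderiv ℝ Y 0 p + Y 0 := funext haff
    rw [h]
    exact ((fderiv ℝ Y 0).contDiff.add contDiff_const).contDiffOn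
  -- The globally smooth map `q ↦ L⁻¹ (q - Y 0)` agrees with `Y.symm` on the target.
  · have hsm : ContDiff ℝ ∞ fun q => L.symm.toContinuousLinearEquiv (q - Y 0) :=
      L.symm.toContinuousLinearEquiv.contDiff.comp (contDiff_id.sub contDiff_const)
    refine hsm.contDiffOn.congr fun q hq => ?_
    have h := hL (Y.symm q)
    rw [Y.right_inv hq] at h
    simp only [LinearEquiv.coe_toContinuousLinearEquiv']
    rw [eq_comm, LinearEquiv.symm_apply_eq, sub_eq_iff_eq_add]
    exact h
  · simp [hL p, add_comm]
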